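/- Let $V$ be a finite-dimensional real vector space with a (Riemannian or semi-Riemannian) metric, that is, a nondegenerate symmetric bilinear form $B$, and let $\ell,k\ge 0$. Let $\mathrm{O}(V)$ be the group of linear isometries of $(V,B)$ and $\mathfrak{so}(V)$ the Lie algebra of $B$-skew-adjoint endomorphisms of $V$, both acting naturally on the exterior powers of $V$. Let $\pi:\Lambda^\ell V\otimes\Lambda^kV\to\Lambda^kV$ be a projection (up to a constant factor) onto the component $\Lambda^kV$ in the decomposition of $\Lambda^\ell V\otimes\Lambda^kV$ obtained by contraction with the metric; more generally, let $\pi$ be any linear map for which at least one of the following holds: (a) $\pi$ is $\mathrm{O}(V)$-equivariant (hence also $\mathfrak{so}(V)$-equivariant); (b) $\pi$ is $\mathfrak{so}(V)$-equivariant and $\ell+2k<\dim V$. For $\Omega\in\Lambda^\ell V$ let the duality operator $b_\Omega:\Lambda^kV\to\Lambda^kV$ be defined by $b_\Omega(F)=\pi(\Omega\otimes F)$. Then $b_\Omega\neq 0$ only if $\ell$ is even and $\ell\le 2k$. -/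

import Mathlib

open scoped TensorProduct

noncomputable section

namespace FormDuality

variable {V : Type*} [AddCommGroup V] [Module ℝ V]

/-- The alternating map `(v₁, …, vₙ) ↦ ∑ᵢ v₁ ∧ … ∧ X vᵢ ∧ … ∧ vₙ`. -/
def derivAlternating (X : Module.End ℝ V) (n : ℕ) : V [⋀^Fin n]→ₗ[ℝ] ⋀[ℝ]^n V :=
  { (∑ i : Fin n, (exteriorPower.ιMulti ℝ n (M := V)).toMultilinearMap.compLinearMap
      (Function.update (fun _ => LinearMap.id) i X)) with
    map_eq_zero_of_eq' := by
      intro v i j hij hne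
      have key : ∀ m : Fin n, (fun a => (Function.update (fun _ => (LinearMap.id : V →ₗ[ℝ] V)) m X :
          Fin n → V →ₗ[ℝ] V) a (v a)) = Function.update v m (X (v m)) := by
        intro m
        funext a
        by_cases h : a = m
        · subst h; simp
        · simp [Function.update_of_ne h]
      simp only [MultilinearMap.toFun_eq_coe, sum_apply,
        MultilinearMap.compLinearMap_apply, AlternatingMap.coe_multilinearMap, key]
      rw [← Finset.sum_subset (Finset.subset_univ {i, j}), Finset.sum_pair hne]
      · have hsw : Function.update v j (X (v j)) =
            Function.update v i (X (v i)) ∘ Equiv.swap i j := by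
          funext a
          by_cases hi : a = i
          · subst hi; simp [Function.update_of_ne hne, Function.update_of_ne hne.symm, hij]
          · by_cases hj : a = j
            · subst hj; simp [hij]
            · simp [Function.update_of_ne hi, Function.update_of_ne hj,
                Equiv.swap_apply_of_ne_of_ne hi hj]
        rw [hsw]
        exact AlternatingMap.map_add_swap _ _ hne
      · intro m _ hm
        simp only [Finset.mem_insert, Finset.mem_singleton, not_or] at hm
        apply AlternatingMap.map_eq_zero_of_eq _ _ _ hne
        rw [Function.update_of_ne (Ne.symm hm.1), Function.update_of_ne (Ne.symm hm.2), hij] }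

/-- The natural action of an endomorphism `X` of `V` (seen as an element of the Lie algebra
`gl(V)`) on `Λⁿ V`, `v₁ ∧ … ∧ vₙ ↦ ∑ᵢ v₁ ∧ … ∧ X vᵢ ∧ … ∧ vₙ`. -/
def lieAct (X : Module.End ℝ V) (n : ℕ) : ⋀[ℝ]^n V →ₗ[ℝ] ⋀[ℝ]^n V :=
  exteriorPower.alternatingMapLinearEquiv (derivAlternating X n)

theorem lieAct_ιMulti (X : Module.End ℝ V) (n : ℕ) (v : Fin n → V) :
    lieAct X n (exteriorPower.ιMulti ℝ n v) =
      ∑ i : Fin n, exteriorPower.ιMulti ℝ n (Function.update v i (X (v i))) := by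
  rw [lieAct, exteriorPower.alternatingMapLinearEquiv_apply_ιMulti]
  change (∑ i : Fin n, (exteriorPower.ιMulti ℝ n (M := V)).toMultilinearMap.compLinearMap
      (Function.update (fun _ => LinearMap.id) i X)) v = _
  rw [sum_apply]
  refine Finset.sum_congr rfl fun m _ => ?_
  rw [MultilinearMap.compLinearMap_apply]
  change exteriorPower.ιMulti ℝ n _ = _
  congr 1
  funext a
  by_cases h : a = m
  · subst h; simp
  · simp [Function.update_of_ne h]

/-- A linear map `π : Λ^ℓ V ⊗ Λ^k V → Λ^k V` is equivariant for the Lie algebra `so(V)` of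
endomorphisms of `V` that are skew-adjoint for the metric `B`:
`π (X α ⊗ β + α ⊗ X β) = X π (α ⊗ β)`. -/
def IsSoEquivariant (B : LinearMap.BilinForm ℝ V) {ℓ k : ℕ}
    (π : (⋀[ℝ]^ℓ V) ⊗[ℝ] (⋀[ℝ]^k V) →ₗ[ℝ] ⋀[ℝ]^k V) : Prop :=
  ∀ X ∈ skewAdjointLieSubalgebra B, ∀ (α : ⋀[ℝ]^ℓ V) (β : ⋀[ℝ]^k V),
    π (lieAct X ℓ α ⊗ₜ[ℝ] β + α ⊗ₜ[ℝ] lieAct X k β) = lieAct X k (π (α ⊗ₜ[ℝ] β))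

/-- A linear map `π : Λ^ℓ V ⊗ Λ^k V → Λ^k V` is equivariant for the group `O(V)` of all linear
isometries of the metric `B`: `π (g α ⊗ g β) = g π (α ⊗ β)`. -/
def IsOrthogonalEquivariant (B : LinearMap.BilinForm ℝ V) {ℓ k : ℕ}
    (π : (⋀[ℝ]^ℓ V) ⊗[ℝ] (⋀[ℝ]^k V) →ₗ[ℝ] ⋀[ℝ]^k V) : Prop :=
  ∀ g : V ≃ₗ[ℝ] V, (∀ x y : V, B (g x) (g y) = B x y) →
    ∀ (α : ⋀[ℝ]^ℓ V) (β : ⋀[ℝ]^k V),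
      π (exteriorPower.map ℓ g.toLinearMap α ⊗ₜ[ℝ] exteriorPower.map k g.toLinearMap β) =
        exteriorPower.map k g.toLinearMap (π (α ⊗ₜ[ℝ] β))

/-- The duality operator `b_Ω : Λ^k V → Λ^k V`, `F ↦ π (Ω ⊗ F)`, of the `ℓ`-form `Ω` with respect
to the projection `π : Λ^ℓ V ⊗ Λ^k V → Λ^k V`. -/
def dualityOperator {ℓ k : ℕ} (π : (⋀[ℝ]^ℓ V) ⊗[ℝ] (⋀[ℝ]^k V) →ₗ[ℝ] ⋀[ℝ]^k V)
    (Ω : ⋀[ℝ]^ℓ V) : ⋀[ℝ]^k V →ₗ[ℝ] ⋀[ℝ]^k V :=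
  π ∘ₗ TensorProduct.mk ℝ (⋀[ℝ]^ℓ V) (⋀[ℝ]^k V) Ω

end FormDuality

end

namespace FormDuality

open Module Set

variable {V : Type*} [AddCommGroup V] [Module ℝ V] {ι : Type*} [LinearOrder ι] {n : ℕ}

/-! Fix a `B`-orthogonal basis `e` and let `e_M` occur in `π (e_L ⊗ e_K)` with nonzero coefficient.
Equivariance forces `M` to be the symmetric difference of `L` and `K`; counting elements then gives
`ℓ = 2 |L ∩ K|`, and `|L ∩ K| ≤ k`. For `O(V)`, the reflection in `e i` compares parities
(`mem_iff_xor_of_isOrthogonalEquivariant`). For `so(V)`, the bound on `ℓ + 2k` leaves an index `j`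
outside `L`, `K` and `M`, and the square of the rotation generator in the plane of `e i` and `e j`
detects whether `i` is present (`mem_iff_xor_of_isSoEquivariant`). -/

theorem lieAct_basis_eq_zero (e : Basis ι ℝ V) (X : Module.End ℝ V) (s : powersetCard ι n)
    (h : ∀ p ∈ s, X (e p) = 0 ∨ ∃ q ∈ s, q ≠ p ∧ ∃ t : ℝ, X (e p) = t • e q) :
    lieAct X n (e.exteriorPower n s) = 0 := by
  rw [exteriorPower.basis_apply, exteriorPower.ιMulti_family, lieAct_ιMulti]
  set f := powersetCard.ofFinEmbEquiv.symm s with hf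
  refine Finset.sum_eq_zero fun m _ => ?_
  rw [Function.comp_apply]
  rcases h (f m) ((powersetCard.mem_range_ofFinEmbEquiv_symm_iff_mem s _).mp ⟨m, rfl⟩) with
    h0 | ⟨q, hq, hqm, t, ht⟩
  · rw [h0]
    exact AlternatingMap.map_coord_zero _ m (by simp)
  · obtain ⟨r, rfl⟩ := (powersetCard.mem_range_ofFinEmbEquiv_symm_iff_mem s q).mpr hq
    have hrm : r ≠ m := fun hrm => hqm (by rw [hrm])
    rw [ht, AlternatingMap.map_update_smul,
      AlternatingMap.map_eq_zero_of_eq _ _ (i := r) (j := m) (by simp [hrm, hf]) hrm, smul_zero]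

/-- If `X` rotates the plane of `e i` and `e j` and kills the other basis vectors, then the basis
vectors of `Λⁿ V` that involve `e i` but not `e j` are eigenvectors of `X²`. -/
theorem lieAct_lieAct_basis (e : Basis ι ℝ V) (X : Module.End ℝ V) {i j : ι} {a b : ℝ}
    (hi : X (e i) = b • e j) (hj : X (e j) = a • e i)
    (h : ∀ m, m ≠ i → m ≠ j → X (e m) = 0) (s : powersetCard ι n) (his : i ∈ s) (hjs : j ∉ s) :
    lieAct X n (lieAct X n (e.exteriorPower n s)) = (a * b) • e.exteriorPower n s := by
  rw [exteriorPower.basis_apply, exteriorPower.ιMulti_family]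
  obtain ⟨p, hp⟩ := (powersetCard.mem_range_ofFinEmbEquiv_symm_iff_mem s i).mpr his
  set f := powersetCard.ofFinEmbEquiv.symm s with hf
  have hfj : ∀ m, f m ≠ j := fun m hm =>
    hjs ((powersetCard.mem_range_ofFinEmbEquiv_symm_iff_mem s j).mp ⟨m, hm⟩)
  have hfi : ∀ m, m ≠ p → f m ≠ i := fun m hm hmi => hm (f.injective (hmi.trans hp.symm))
  have rotate : ∀ (w y : V), X w = y →
      lieAct X n (exteriorPower.ιMulti ℝ n (Function.update (e ∘ f) p w)) =
        exteriorPower.ιMulti ℝ n (Function.update (e ∘ f) p y) := by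
    intro w y hwy
    rw [lieAct_ιMulti, Finset.sum_eq_single p]
    · simp [hwy]
    · intro m _ hm
      apply AlternatingMap.map_coord_zero _ m
      rw [Function.update_self, Function.update_of_ne hm]
      exact h _ (hfi m hm) (hfj m)
    · simp
  have h1 : e ∘ f = Function.update (e ∘ f) p (e i) := by
    rw [← hp]; exact (Function.update_eq_self p (e ∘ f)).symm
  conv_lhs => rw [h1]
  rw [rotate _ _ hi, rotate _ ((a * b) • e i) (by rw [map_smul, hj, smul_smul, mul_comm]),
    AlternatingMap.map_update_smul, ← h1]

/-- An endomorphism that is diagonal in a basis acts diagonally on the coordinates. -/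
theorem repr_apply_of_diagonal {W κ : Type*} [AddCommGroup W] [Module ℝ W] (b : Basis κ ℝ W)
    (T : W →ₗ[ℝ] W) (c : κ → ℝ) (hT : ∀ m, T (b m) = c m • b m) (x : W) (m : κ) :
    b.repr (T x) m = c m * b.repr x m := by
  have : b.coord m ∘ₗ T = c m • b.coord m := by
    refine b.ext fun r => ?_
    by_cases hr : r = m
    · subst hr; simp [hT]
    · simp [hT, Finsupp.single_eq_of_ne (Ne.symm hr)]
  simpa using LinearMap.congr_fun this x

open scoped Classical in
theorem map_basis_of_reflection (e : Basis ι ℝ V) (g : V →ₗ[ℝ] V) (i : ι)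
    (hi : g (e i) = -e i) (h : ∀ m, m ≠ i → g (e m) = e m) (s : powersetCard ι n) :
    exteriorPower.map n g (e.exteriorPower n s) =
      (if i ∈ s then (-1 : ℝ) else 1) • e.exteriorPower n s := by
  rw [exteriorPower.basis_apply, exteriorPower.map_apply_ιMulti_family,
    exteriorPower.ιMulti_family, exteriorPower.ιMulti_family]
  set f := powersetCard.ofFinEmbEquiv.symm s with hf
  split_ifs with his
  · obtain ⟨p, hp⟩ := (powersetCard.mem_range_ofFinEmbEquiv_symm_iff_mem s i).mpr his
    have : (⇑g ∘ ⇑e) ∘ f = Function.update (e ∘ f) p ((-1 : ℝ) • (e ∘ f) p) := by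
      funext m
      by_cases hm : m = p
      · subst hm
        have hp' : f m = i := hp
        simp [hp', hi]
      · have : f m ≠ i := fun hmi => hm (f.injective (hmi.trans hp.symm))
        simp [Function.update_of_ne hm, h _ this]
    change exteriorPower.ιMulti ℝ n ((⇑g ∘ ⇑e) ∘ f) = _
    rw [this, AlternatingMap.map_update_smul, Function.update_eq_self]
  · rw [one_smul]
    congr 1
    funext m
    refine h _ fun hmi => his ?_
    exact (powersetCard.mem_range_ofFinEmbEquiv_symm_iff_mem s i).mp ⟨m, hmi⟩

/-- The reflection negating `e i` is an isometry because `e` is orthogonal. It scales `e_S` by `-1`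
exactly when `i ∈ S`, so a nonzero coefficient forces the signs of `L` and `K` to multiply to that
of `M`. -/
theorem mem_iff_xor_of_isOrthogonalEquivariant {B : LinearMap.BilinForm ℝ V} (e : Basis ι ℝ V)
    (he : B.IsOrthoᵢ e) {ℓ k : ℕ} {π : (⋀[ℝ]^ℓ V) ⊗[ℝ] (⋀[ℝ]^k V) →ₗ[ℝ] ⋀[ℝ]^k V}
    (hπ : IsOrthogonalEquivariant B π) (L : powersetCard ι ℓ) (K M : powersetCard ι k)
    (hne : (e.exteriorPower k).repr (π (e.exteriorPower ℓ L ⊗ₜ[ℝ] e.exteriorPower k K)) M ≠ 0)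
    (i : ι) : i ∈ M ↔ Xor (i ∈ L) (i ∈ K) := by
  let u : ι → ℝˣ := fun m => if m = i then -1 else 1
  let g : V ≃ₗ[ℝ] V := e.equiv (e.unitsSMul u) (Equiv.refl ι)
  have hg : ∀ m, g (e m) = (u m : ℝ) • e m := fun m => by
    simp [g, Basis.unitsSMul_apply, Units.smul_def]
  have hB : ∀ x y : V, B (g x) (g y) = B x y := by
    have : B.compl₁₂ g.toLinearMap g.toLinearMap = B := by
      refine LinearMap.BilinForm.ext_basis e fun p q => ?_
      have : B.compl₁₂ g.toLinearMap g.toLinearMap (e p) (e q) = B (g (e p)) (g (e q)) := rfl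
      rw [this, hg, hg]
      by_cases hpq : p = q
      · subst hpq
        by_cases hp : p = i <;> simp [u, hp]
      · have : B (e p) (e q) = 0 := he hpq
        simp [this]
    exact fun x y => LinearMap.congr_fun₂ this x y
  have hgi : g.toLinearMap (e i) = -e i := by simp [hg, u]
  have hgm : ∀ m, m ≠ i → g.toLinearMap (e m) = e m := fun m hm => by simp [hg, u, hm]
  have key := congrArg (fun x => (e.exteriorPower k).repr x M)
    (hπ g hB (e.exteriorPower ℓ L) (e.exteriorPower k K))
  simp only [map_basis_of_reflection e g.toLinearMap i hgi hgm] at key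
  rw [repr_apply_of_diagonal (e.exteriorPower k) _ _
    (map_basis_of_reflection e g.toLinearMap i hgi hgm)] at key
  simp only [← TensorProduct.smul_tmul', TensorProduct.tmul_smul, map_smul, Finsupp.smul_apply,
    smul_eq_mul, ← mul_assoc] at key
  have key' := mul_right_cancel₀ hne key
  by_cases h1 : i ∈ L <;> by_cases h2 : i ∈ K <;> by_cases h3 : i ∈ M <;>
    revert key' <;> norm_num [h1, h2, h3]

/-- The generator of the rotations in the plane of `x` and `y`. -/
def planeRotation (B : LinearMap.BilinForm ℝ V) (x y : V) : Module.End ℝ V :=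
  (B x).smulRight y - (B y).smulRight x

theorem planeRotation_apply (B : LinearMap.BilinForm ℝ V) (x y v : V) :
    planeRotation B x y v = B x v • y - B y v • x := rfl

theorem planeRotation_mem {B : LinearMap.BilinForm ℝ V} (hB : B.IsSymm) (x y : V) :
    planeRotation B x y ∈ skewAdjointLieSubalgebra B := by
  change planeRotation B x y ∈ B.skewAdjointSubmodule
  rw [LinearMap.mem_skewAdjointSubmodule]
  intro v w
  simp only [planeRotation_apply, Pi.neg_apply, map_sub, map_smul, map_neg,
    LinearMap.sub_apply, LinearMap.smul_apply, smul_eq_mul]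
  rw [hB.eq v x, hB.eq v y]
  ring

open scoped Classical in
theorem mem_iff_xor_of_isSoEquivariant {B : LinearMap.BilinForm ℝ V} (hB : B.IsSymm)
    (e : Basis ι ℝ V) (he : B.IsOrthoᵢ e) (he0 : ∀ i, B (e i) (e i) ≠ 0) {ℓ k : ℕ}
    {π : (⋀[ℝ]^ℓ V) ⊗[ℝ] (⋀[ℝ]^k V) →ₗ[ℝ] ⋀[ℝ]^k V} (hπ : IsSoEquivariant B π)
    (L : powersetCard ι ℓ) (K M : powersetCard ι k)
    (hne : (e.exteriorPower k).repr (π (e.exteriorPower ℓ L ⊗ₜ[ℝ] e.exteriorPower k K)) M ≠ 0)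
    {j : ι} (hjL : j ∉ L) (hjK : j ∉ K) (hjM : j ∉ M) (i : ι) :
    i ∈ M ↔ Xor (i ∈ L) (i ∈ K) := by
  by_cases hij : i = j
  · subst hij; simp [hjL, hjK, hjM]
  set X := planeRotation B (e i) (e j) with hX
  -- The nonzero eigenvalue of `X²`. Its sign depends on the signature; only `c ≠ 0` matters below.
  set c : ℝ := -B (e j) (e j) * B (e i) (e i) with hc
  have hc0 : c ≠ 0 := mul_ne_zero (neg_ne_zero.mpr (he0 j)) (he0 i)
  have ho : ∀ p q, p ≠ q → B (e p) (e q) = 0 := fun p q hpq => he hpq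
  have hXi : X (e i) = B (e i) (e i) • e j := by
    simp [hX, planeRotation_apply, ho j i (Ne.symm hij)]
  have hXj : X (e j) = (-B (e j) (e j)) • e i := by
    simp [hX, planeRotation_apply, ho i j hij]
  have hXm : ∀ m, m ≠ i → m ≠ j → X (e m) = 0 := fun m hmi hmj => by
    simp [hX, planeRotation_apply, ho i m (Ne.symm hmi), ho j m (Ne.symm hmj)]
  -- If `s` contains both indices, `X` turns one factor into a multiple of the other, so each
  -- summand has a repeated or zero factor.
  have kill : ∀ {n : ℕ} (s : powersetCard ι n), (i ∈ s ↔ j ∈ s) →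
      lieAct X n (e.exteriorPower n s) = 0 := by
    intro n s hs
    refine lieAct_basis_eq_zero e X s fun m hm => ?_
    by_cases hmi : m = i
    · subst hmi
      exact Or.inr ⟨j, hs.mp hm, Ne.symm hij, _, hXi⟩
    by_cases hmj : m = j
    · subst hmj
      exact Or.inr ⟨i, hs.mpr hm, hij, _, hXj⟩
    exact Or.inl (hXm m hmi hmj)
  have eig : ∀ {n : ℕ} (s : powersetCard ι n), ¬ (i ∈ s ↔ j ∈ s) →
      lieAct X n (lieAct X n (e.exteriorPower n s)) = c • e.exteriorPower n s := by
    intro n s hs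
    by_cases his : i ∈ s
    · exact lieAct_lieAct_basis e X hXi hXj hXm s his (by tauto)
    · rw [hc, mul_comm]
      exact lieAct_lieAct_basis e X hXj hXi (fun m h1 h2 => hXm m h2 h1) s (by tauto) his
  clear_value c
  set D := lieAct X k
  have square : ∀ x, (e.exteriorPower k).repr (D (D x)) M =
      (if (i ∈ M ↔ j ∈ M) then 0 else c) * (e.exteriorPower k).repr x M := fun x =>
    repr_apply_of_diagonal (e.exteriorPower k) (D ∘ₗ D)
      (fun s => if (i ∈ s ↔ j ∈ s) then 0 else c)
      (fun s => by
        rw [LinearMap.comp_apply]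
        split_ifs with hs
        · rw [kill s hs, map_zero, zero_smul]
        · exact eig s hs) x M
  set α := e.exteriorPower ℓ L
  set β := e.exteriorPower k K
  have leibniz : ∀ x y, D (π (x ⊗ₜ[ℝ] y)) =
      π (lieAct X ℓ x ⊗ₜ[ℝ] y) + π (x ⊗ₜ[ℝ] D y) := fun x y => by
    rw [← map_add]; exact (hπ X (planeRotation_mem hB _ _) x y).symm
  have eig_or_kill : ∀ {n : ℕ} (s : powersetCard ι n), j ∉ s →
      (i ∈ s ∧ lieAct X n (lieAct X n (e.exteriorPower n s)) = c • e.exteriorPower n s) ∨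
      (i ∉ s ∧ lieAct X n (e.exteriorPower n s) = 0) := fun s hjs => by
    by_cases his : i ∈ s
    · exact Or.inl ⟨his, eig s (by tauto)⟩
    · exact Or.inr ⟨his, kill s (by tauto)⟩
  have sq := square (π (α ⊗ₜ[ℝ] β))
  have hLX : (i ∈ L ∧ lieAct X ℓ (lieAct X ℓ α) = c • α) ∨ (i ∉ L ∧ lieAct X ℓ α = 0) :=
    eig_or_kill L hjL
  have hKX : (i ∈ K ∧ D (D β) = c • β) ∨ (i ∉ K ∧ D β = 0) := eig_or_kill K hjK
  rcases hLX with ⟨hL, hLX⟩ | ⟨hL, hLX⟩ <;>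
    rcases hKX with ⟨hK, hKX⟩ | ⟨hK, hKX⟩
  -- When `i` lies in both `L` and `K`, the cross term survives, so `π (α ⊗ β)` need not be an
  -- eigenvector of `D²`. Still `D⁴ = 4c D²` on it, so only the eigenvalues `0` and `4c` can occur.
  -- As `c ≠ 0`, neither equals `c`, which excludes `i ∈ M`.
  · have h2 : D (D (π (α ⊗ₜ[ℝ] β))) =
        (2 * c) • π (α ⊗ₜ[ℝ] β) + (2 : ℝ) • π (lieAct X ℓ α ⊗ₜ[ℝ] D β) := by
      simp only [leibniz, map_add, hLX, hKX, ← TensorProduct.smul_tmul',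
        TensorProduct.tmul_smul, map_smul]
      module
    have h4 : D (D (D (D (π (α ⊗ₜ[ℝ] β))))) = (4 * c) • D (D (π (α ⊗ₜ[ℝ] β))) := by
      rw [h2]
      simp only [leibniz, map_add, hLX, hKX, ← TensorProduct.smul_tmul',
        TensorProduct.tmul_smul, map_smul]
      module
    have sq4 := square (D (D (π (α ⊗ₜ[ℝ] β))))
    rw [h4, map_smul, Finsupp.smul_apply, sq, smul_eq_mul] at sq4
    have hM : i ∉ M := fun hM => by
      simp only [hM, hjM, iff_false, not_true, if_false] at sq4
      have : 3 * c * c * (e.exteriorPower k).repr (π (α ⊗ₜ[ℝ] β)) M = 0 := by linarith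
      simp_all
    simp [hL, hK, hM]
  · have h2 : D (D (π (α ⊗ₜ[ℝ] β))) = c • π (α ⊗ₜ[ℝ] β) := by
      simp only [leibniz, hLX, hKX, ← TensorProduct.smul_tmul',
        map_smul, TensorProduct.tmul_zero, map_zero, add_zero]
    have hM : i ∈ M := by
      by_contra hM
      rw [h2] at sq
      simp [hM, hjM, hc0, hne] at sq
    simp [hL, hK, hM]
  · have h2 : D (D (π (α ⊗ₜ[ℝ] β))) = c • π (α ⊗ₜ[ℝ] β) := by
      simp only [leibniz, hLX, hKX, TensorProduct.tmul_smul,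
        map_smul, TensorProduct.zero_tmul, map_zero, zero_add]
    have hM : i ∈ M := by
      by_contra hM
      rw [h2] at sq
      simp [hM, hjM, hc0, hne] at sq
    simp [hL, hK, hM]
  · have h1 : D (π (α ⊗ₜ[ℝ] β)) = 0 := by
      simp only [leibniz, hLX, hKX, TensorProduct.zero_tmul, TensorProduct.tmul_zero,
        map_zero, add_zero]
    have hM : i ∉ M := fun hM => by
      rw [h1] at sq
      simp [hM, hjM, hc0, hne] at sq
    simp [hL, hK, hM]

end FormDuality

theorem lemma2p5 {V : Type*} [AddCommGroup V] [Module ℝ V] [FiniteDimensional ℝ V]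
    (B : LinearMap.BilinForm ℝ V) (hsymm : B.IsSymm) (hnondeg : B.Nondegenerate)
    (ℓ k : ℕ) (Ω : ⋀[ℝ]^ℓ V)
    (π : (⋀[ℝ]^ℓ V) ⊗[ℝ] (⋀[ℝ]^k V) →ₗ[ℝ] ⋀[ℝ]^k V)
    (hπ : FormDuality.IsOrthogonalEquivariant B π ∨
      (FormDuality.IsSoEquivariant B π ∧ ℓ + 2 * k < Module.finrank ℝ V))
    (hb : FormDuality.dualityOperator π Ω ≠ 0) :
    Even ℓ ∧ ℓ ≤ 2 * k := by
  obtain ⟨e, he⟩ := LinearMap.BilinForm.exists_orthogonal_basis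
    (LinearMap.BilinForm.isSymm_iff.mp hsymm)
  have he0 : ∀ i, B (e i) (e i) ≠ 0 := he.not_isOrtho_basis_self_of_separatingLeft hnondeg.1
  have hπ0 : π ≠ 0 := by
    rintro rfl
    exact hb (by simp [FormDuality.dualityOperator])
  obtain ⟨L, K, M, hne⟩ : ∃ L K M, (e.exteriorPower k).repr
      (π (e.exteriorPower ℓ L ⊗ₜ[ℝ] e.exteriorPower k K)) M ≠ 0 := by
    by_contra! h
    refine hπ0 (((e.exteriorPower ℓ).tensorProduct (e.exteriorPower k)).ext fun p => ?_)
    rw [Module.Basis.tensorProduct_apply', LinearMap.zero_apply]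
    exact (e.exteriorPower k).ext_elem fun M => by simpa using h p.1 p.2 M
  have hxor : ∀ i, i ∈ M ↔ Xor (i ∈ L) (i ∈ K) := by
    rcases hπ with hO | ⟨hso, hdim⟩
    · exact FormDuality.mem_iff_xor_of_isOrthogonalEquivariant e he hO L K M hne
    · have hcard : (L.val ∪ K.val ∪ M.val).card < Fintype.card (Fin (Module.finrank ℝ V)) := by
        have h1 := Finset.card_union_le (L.val ∪ K.val) M.val
        have h2 := Finset.card_union_le L.val K.val
        have hL := Set.powersetCard.card_eq L
        have hK := Set.powersetCard.card_eq K
        have hM := Set.powersetCard.card_eq M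
        rw [Fintype.card_fin]
        omega
      obtain ⟨j, hj⟩ : ∃ j, j ∉ L.val ∪ K.val ∪ M.val := by
        by_contra! h
        exact hcard.ne (by rw [Finset.eq_univ_of_forall h, Finset.card_univ])
      simp only [Finset.mem_union, not_or] at hj
      exact FormDuality.mem_iff_xor_of_isSoEquivariant hsymm e he he0 hso L K M hne
        hj.1.1 hj.1.2 hj.2
  have hM : M.val = (L.val \ K.val) ∪ (K.val \ L.val) := by
    ext i
    rw [Finset.mem_union, Finset.mem_sdiff, Finset.mem_sdiff]
    exact hxor i
  have h1 := Finset.card_union_of_disjoint (s := L.val \ K.val) (t := K.val \ L.val)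
    disjoint_sdiff_sdiff
  have h2 := Finset.card_sdiff_add_card_inter L.val K.val
  have h3 := Finset.card_sdiff_add_card_inter K.val L.val
  rw [Finset.inter_comm] at h3
  rw [← hM] at h1
  have hLc : L.val.card = ℓ := Set.powersetCard.card_eq L
  have hKc : K.val.card = k := Set.powersetCard.card_eq K
  have hMc : M.val.card = k := Set.powersetCard.card_eq M
  -- With `m = |L ∩ K|`, the count reads `k = (ℓ - m) + (k - m)`.
  refine ⟨⟨(L.val ∩ K.val).card, ?_⟩, ?_⟩ <;> omega
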